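/- Let $n\ge 0$ and let $B_n$ be the hyperoctahedral group, i.e. the Coxeter group with simple generators $s_0,\dots,s_{n-1}$ and $m(s_0,s_1)=4$, $m(s_i,s_{i+1})=3$ for $1\le i\le n-2$, $m(s_i,s_j)=2$ for $|i-j|\ge 2$; let $\ell$ be its length function and let $\mathrm{Des}(x)=\{i\in\{0,\dots,n-1\}:\ell(s_ix)<\ell(x)\}$ for $x\in B_n$. Let $H_n^B(0)$ be the $0$-Hecke algebra of $B_n$ over $\mathbb C$, generated by $\pi_0,\dots,\pi_{n-1}$ with relations $\pi_i^2=-\pi_i$ and $\cdots\pi_j\pi_i\pi_j=\cdots\pi_i\pi_j\pi_i$ ($m(s_i,s_j)$ factors on each side) for $i\ne j$. For $I\subseteq\{0,\dots,n-1\}$ let $\mathcal S_I^B$ be the one-dimensional $H_n^B(0)$-module on which $\pi_j$ acts as $-1$ if $j\in I$ and as $0$ otherwise, and let \[F_I^B=\sum_{\substack{0=i_0\le i_1\le\cdots\le i_n\\ j\in I\Rightarrow i_j<i_{j+1}}}x_{i_1}x_{i_2}\cdots x_{i_n}.\] Let $\mathcal G_0(H_n^B(0))$ be the Grothendieck group of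 finitely generated $H_n^B(0)$-modules (generated by isomorphism classes, modulo $[A]-[B]+[C]=0$ for each short exact sequence $0\to A\to B\to C\to 0$), and let $\mathrm{ch}^B$ be the unique homomorphism from it to the power series in $x_0,x_1,\dots$ with $\mathrm{ch}^B([\mathcal S_I^B])=F_I^B$ for all $I$; write $\mathrm{ch}^B(M)=\mathrm{ch}^B([M])$. Let $X\subseteq B_n$ be ascent-compatible: for all $u,v\in X$ and all $i,j$ with $i\notin\mathrm{Des}(u)$, $j\notin\mathrm{Des}(v)$ and $u^{-1}s_iu=v^{-1}s_jv$, one has $s_iu\in X$ if and only if $s_jv\in X$. Then the linear operators on the complex vector space $\mathbb CX$ with basis $X$ given, for $x\in X$, by \[\pi_i(x)=\begin{cases}-x&\text{if } i\in\mathrm{Des}(x),\\ 0&\text{if } i\notin\mathrm{Des}(x)\text{ and }s_ix\notin X,\\ s_ix&\text{if } i\notin\mathrm{Des}(x)\text{ and }s_ix\in X\end{cases}\] define an $H_n^B(0)$-module structure on $\mathbb CX$, and \[\mathrm{ch}^B(\mathbb CX)=\sum_{x\in X}F^B_{\mathrm{Des}(x)}.\] -/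

import Mathlib

namespace TypeB

/-- The relations of the generators `s_0, …, s_{n-1}` of type `B_n` in a monoid, with `s_i² = 1` or
`s_i² = s_i`. This and the facts on chains below serve to show that the hyperoctahedral group is
finite, that its `0`-Hecke algebra is finite-dimensional, and that the simple modules of the latter
are one-dimensional. -/
structure ChainRel {G : Type*} [Monoid G] (s : ℕ → G) (n : ℕ) : Prop where
  sq : ∀ i, i < n → s i * s i = 1 ∨ s i * s i = s i
  comm : ∀ i j, i + 2 ≤ j → j < n → s i * s j = s j * s i
  braid : ∀ i, 1 ≤ i → i + 1 < n → s i * s (i + 1) * s i = s (i + 1) * s i * s (i + 1)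
  four : 1 < n → s 0 * s 1 * s 0 * s 1 = s 1 * s 0 * s 1 * s 0

/-- The minimal coset representatives `1, s_k, s_{k-1} s_k, …, s_0 ⋯ s_k, s_1 s_0 s_1 ⋯ s_k, …` of
`B_{k+1}` modulo `B_k`. -/
def chain {G : Type*} [Monoid G] (s : ℕ → G) (k : ℕ) : ℕ → G
  | 0 => 1
  | j + 1 => s (if j ≤ k then k - j else j - k) * chain s k j

section
variable {G : Type*} [Monoid G] {s : ℕ → G} {n k : ℕ}

theorem chain_succ_of_le {j : ℕ} (h : j ≤ k) : chain s k (j + 1) = s (k - j) * chain s k j := by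
  simp [chain, h]

theorem chain_up (t : ℕ) : chain s k (k + 1 + t + 1) = s (t + 1) * chain s k (k + 1 + t) := by
  rw [chain, if_neg (by omega)]
  congr 2
  omega

theorem chain_comm_low (H : ChainRel s n) (hk : k < n) {i j : ℕ} (h : i + j + 1 ≤ k) :
    s i * chain s k j = chain s k j * s i := by
  induction j with
  | zero => simp [chain]
  | succ j ih =>
    rw [chain_succ_of_le (by omega), ← mul_assoc, H.comm i (k - j) (by omega) (by omega),
      mul_assoc, ih (by omega), mul_assoc]

theorem chain_shift (H : ChainRel s n) (hk : k < n) {m j : ℕ} (hm : 1 ≤ m) (hj : j ≤ k + 1)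
    (h : k + 1 ≤ m + j) (hmk : m + 1 ≤ k) :
    s (m + 1) * chain s k j = chain s k j * s m := by
  induction j with
  | zero => omega
  | succ j ih =>
    rw [chain_succ_of_le (by omega)]
    rcases Nat.lt_or_ge (k - j) m with hlt | hge
    · rw [← mul_assoc, ← H.comm (k - j) (m + 1) (by omega) (by omega), mul_assoc,
        ih (by omega) (by omega), mul_assoc]
    · have hmj : k - j = m := by omega
      obtain ⟨j, rfl⟩ : ∃ j', j = j' + 1 := ⟨j - 1, by omega⟩
      have hm1 : k - j = m + 1 := by omega
      rw [hmj, chain_succ_of_le (by omega), hm1, ← mul_assoc, ← mul_assoc,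
        ← H.braid m hm (by omega), mul_assoc, chain_comm_low H hk (by omega)]
      simp only [mul_assoc]

theorem chain_shift_up (H : ChainRel s n) (hk : k < n) {m t : ℕ} (h : t + 1 ≤ m)
    (hmk : m + 1 ≤ k) :
    s (m + 1) * chain s k (k + 1 + t) = chain s k (k + 1 + t) * s m := by
  induction t with
  | zero => exact chain_shift H hk (by omega) (by omega) (by omega) hmk
  | succ t ih =>
    rw [← add_assoc, chain_up, ← mul_assoc, ← H.comm (t + 1) (m + 1) (by omega) (by omega),
      mul_assoc, ih (by omega), mul_assoc]

theorem chain_comm_up (H : ChainRel s n) (hk : k < n) {i t : ℕ} (h : i < t) (ht : t ≤ k) :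
    s i * chain s k (k + 1 + t) = chain s k (k + 1 + t) * s i := by
  induction t with
  | zero => omega
  | succ t ih =>
    rw [← add_assoc, chain_up]
    rcases Nat.lt_or_ge i t with hlt | hge
    · rw [← mul_assoc, H.comm i (t + 1) (by omega) (by omega), mul_assoc, ih hlt (by omega),
        mul_assoc]
    · obtain rfl : i = t := by omega
      cases i with
      | zero =>
        obtain ⟨k, rfl⟩ : ∃ k', k = k' + 1 := ⟨k - 1, by omega⟩
        have e : chain s (k + 1) (k + 1 + 1 + 0) = s 0 * (s 1 * chain s (k + 1) k) := by
          rw [add_zero, chain_succ_of_le (by omega), chain_succ_of_le (by omega)]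
          simp
        have c := chain_comm_low (s := s) (k := k + 1) H hk (i := 0) (j := k) (by omega)
        have f := congrArg (· * chain s (k + 1) k) (H.four (by omega))
        simp only [mul_assoc, c] at f
        rw [e]
        simpa only [mul_assoc, zero_add] using f
      | succ i =>
        have c := chain_shift_up (s := s) H hk (m := i + 1) (t := i) (by omega) (by omega)
        have f := congrArg (· * chain s k (k + 1 + i)) (H.braid (i + 1) (by omega) (by omega))
        simp only [mul_assoc, c] at f
        rw [← add_assoc, chain_up]
        simpa only [mul_assoc] using f

theorem chain_step (H : ChainRel s n) (hk : k < n) {i j : ℕ} (hi : i ≤ k) (hj : j ≤ 2 * k + 1) :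
    (∃ l, l < k ∧ s i * chain s k j = chain s k j * s l) ∨
    (j < 2 * k + 1 ∧ s i * chain s k j = chain s k (j + 1)) ∨
    (∃ j', j = j' + 1 ∧ chain s k j = s i * chain s k j') := by
  rcases Nat.lt_or_ge k j with hkj | hkj
  · obtain ⟨t, rfl⟩ : ∃ t, j = k + 1 + t := ⟨j - (k + 1), by omega⟩
    rcases lt_trichotomy i t with h | h | h
    · exact Or.inl ⟨i, by omega, chain_comm_up H hk h (by omega)⟩
    · subst h
      refine Or.inr (Or.inr ⟨k + i, by omega, ?_⟩)
      cases i with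
      | zero => rw [add_zero, add_zero, chain_succ_of_le le_rfl, Nat.sub_self]
      | succ i => rw [← add_assoc, chain_up]; congr 2; omega
    · rcases Nat.lt_or_ge (t + 1) i with h' | h'
      · obtain ⟨m, rfl⟩ : ∃ m, i = m + 1 := ⟨i - 1, by omega⟩
        exact Or.inl ⟨m, by omega, chain_shift_up H hk (by omega) hi⟩
      · obtain rfl : i = t + 1 := by omega
        exact Or.inr (Or.inl ⟨by omega, (chain_up t).symm⟩)
  · rcases lt_trichotomy (i + j) k with h | h | h
    · exact Or.inl ⟨i, by omega, chain_comm_low H hk (by omega)⟩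
    · refine Or.inr (Or.inl ⟨by omega, ?_⟩)
      rw [chain_succ_of_le hkj]
      congr 2
      omega
    · rcases Nat.lt_or_ge (k + 1) (i + j) with h' | h'
      · obtain ⟨m, rfl⟩ : ∃ m, i = m + 1 := ⟨i - 1, by omega⟩
        exact Or.inl ⟨m, by omega, chain_shift H hk (by omega) (by omega) (by omega) hi⟩
      · obtain ⟨j, rfl⟩ : ∃ j', j = j' + 1 := ⟨j - 1, by omega⟩
        refine Or.inr (Or.inr ⟨j, rfl, ?_⟩)
        rw [chain_succ_of_le (by omega)]
        congr 2
        omega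

theorem finite_closure (H : ChainRel s n) :
    ∀ k, k ≤ n → (Submonoid.closure (s '' {i | i < k}) : Set G).Finite := by
  intro k
  induction k with
  | zero => intro _; simp
  | succ k ih =>
    intro hk
    set N := Submonoid.closure (s '' {i | i < k}) with hN
    have hfin := ih (by omega)
    refine ((Set.Finite.image2 (fun j x => chain s k j * x)
      (Set.finite_le_nat (2 * k + 1)) hfin).subset ?_)
    intro x hx
    induction hx using Submonoid.closure_induction_left with
    | one => exact ⟨0, by simp, 1, N.one_mem, by simp [chain]⟩
    | mul_left x hx y _ hy =>
      obtain ⟨i, hi, rfl⟩ := hx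
      obtain ⟨j, hj, z, hz, rfl⟩ := hy
      simp only [Set.mem_ofPred_eq] at hi hj
      rcases chain_step H (by omega) (by omega : i ≤ k) hj with ⟨l, hl, e⟩ | ⟨hj', e⟩ | ⟨j', rfl, e⟩
      · refine ⟨j, hj, s l * z, N.mul_mem (Submonoid.subset_closure ⟨l, hl, rfl⟩) hz, ?_⟩
        simp only
        rw [← mul_assoc, ← mul_assoc, e]
      · refine ⟨j + 1, by simp only [Set.mem_ofPred_eq]; omega, z, hz, ?_⟩
        simp only
        rw [← mul_assoc, e]
      · rcases H.sq i (by omega) with h1 | h1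
        · refine ⟨j', by simp only [Set.mem_ofPred_eq]; omega, z, hz, ?_⟩
          simp only
          rw [e, ← mul_assoc, ← mul_assoc, h1, one_mul]
        · refine ⟨j' + 1, hj, z, hz, ?_⟩
          simp only
          rw [e, ← mul_assoc, ← mul_assoc, h1]

end


theorem exists_eigenvector {K V : Type*} [Field K] [AddCommGroup V] [Module K V] [Nontrivial V]
    {n : ℕ} {s : ℕ → Module.End K V} (H : ChainRel s n) (hid : ∀ i, i < n → s i * s i = s i) :
    ∀ k, k ≤ n → ∃ v : V, v ≠ 0 ∧ ∀ i, i < k → ∃ a : K, s i v = a • v := by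
  classical
  intro k
  induction k with
  | zero => intro _; obtain ⟨v, hv⟩ := exists_ne (0 : V); exact ⟨v, hv, by simp⟩
  | succ k ih =>
    intro hk
    obtain ⟨v, hv, hev⟩ := ih (by omega)
    have h0 : (0 : ℕ) ≤ 2 * k + 1 ∧ chain s k 0 v ≠ 0 := ⟨by omega, by simpa [chain] using hv⟩
    set j := Nat.findGreatest (fun j => chain s k j v ≠ 0) (2 * k + 1) with hj
    have hjle : j ≤ 2 * k + 1 := Nat.findGreatest_le _
    have hjv : chain s k j v ≠ 0 :=
      Nat.findGreatest_spec (P := fun j => chain s k j v ≠ 0) h0.1 h0.2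
    refine ⟨chain s k j v, hjv, fun i hi => ?_⟩
    rcases chain_step H (by omega) (by omega : i ≤ k) hjle with ⟨l, hl, e⟩ | ⟨hj', e⟩ | ⟨j', _, e⟩
    · obtain ⟨a, ha⟩ := hev l hl
      refine ⟨a, ?_⟩
      rw [← Module.End.mul_apply, e, Module.End.mul_apply, ha, map_smul]
    · refine ⟨0, ?_⟩
      rw [← Module.End.mul_apply, e, zero_smul]
      by_contra hne
      have := Nat.le_findGreatest (P := fun j => chain s k j v ≠ 0) (n := 2 * k + 1)
        (m := j + 1) (by omega) hne
      omega
    · refine ⟨1, ?_⟩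
      rw [← Module.End.mul_apply, e, ← mul_assoc, hid i (by omega), one_smul]

/-- The Coxeter matrix of type `B_n`, with simple generators `s_0, …, s_{n-1}` indexed by `Fin n`:
`m(s_0, s_1) = 4`, `m(s_i, s_{i+1}) = 3` for `1 ≤ i`, and `m(s_i, s_j) = 2` for `|i - j| ≥ 2`. -/
def matrixB (n : ℕ) : CoxeterMatrix (Fin n) where
  M := Matrix.of fun i j : Fin n ↦
    if i = j then 1
    else if (i : ℕ) + 1 = j ∨ (j : ℕ) + 1 = i then
      (if (i : ℕ) = 0 ∨ (j : ℕ) = 0 then 4 else 3)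
    else 2
  isSymm := by
    ext i j
    simp only [Matrix.transpose_apply, Matrix.of_apply]
    grind
  diagonal := by simp
  off_diagonal := by
    intro i j h
    simp only [Matrix.of_apply]
    grind

theorem matrixB_apply (n : ℕ) (i j : Fin n) : matrixB n i j =
    if i = j then 1
    else if (i : ℕ) + 1 = j ∨ (j : ℕ) + 1 = i then
      (if (i : ℕ) = 0 ∨ (j : ℕ) = 0 then 4 else 3)
    else 2 := rfl

section Hecke

variable {B : Type} (M : CoxeterMatrix B)

/-- The defining relations of the `0`-Hecke algebra: `π_s² = -π_s`, and
`[π_s | π_t]_{m(s,t)} = [π_t | π_s]_{m(s,t)}` for distinct `s, t` with `m(s,t)` finite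
(an infinite `m(s,t)` is encoded by `0`). -/
inductive HeckeRel : FreeAlgebra ℂ B → FreeAlgebra ℂ B → Prop
  | quad (s : B) : HeckeRel (FreeAlgebra.ι ℂ s * FreeAlgebra.ι ℂ s) (-FreeAlgebra.ι ℂ s)
  | braid (s t : B) (hst : s ≠ t) (hm : M s t ≠ 0) :
      HeckeRel
        ((CoxeterSystem.alternatingWord s t (M s t)).map (FreeAlgebra.ι ℂ)).prod
        ((CoxeterSystem.alternatingWord t s (M s t)).map (FreeAlgebra.ι ℂ)).prod

/-- The `0`-Hecke algebra over `ℂ`. -/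
abbrev ZeroHecke : Type := RingQuot (HeckeRel M)

namespace ZeroHecke

/-- The generator `π_s`. -/
def gen (s : B) : ZeroHecke M := RingQuot.mkAlgHom ℂ (HeckeRel M) (FreeAlgebra.ι ℂ s)

variable {M}

theorem gen_sq (s : B) : gen M s * gen M s = -gen M s := by
  have := RingQuot.mkAlgHom_rel ℂ (HeckeRel.quad (M := M) s)
  simpa [gen] using this

theorem gen_braid (s t : B) (hst : s ≠ t) (hm : M s t ≠ 0) :
    ((CoxeterSystem.alternatingWord s t (M s t)).map (gen M)).prod =
      ((CoxeterSystem.alternatingWord t s (M s t)).map (gen M)).prod := by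
  have := RingQuot.mkAlgHom_rel ℂ (HeckeRel.braid (M := M) s t hst hm)
  simp only [map_list_prod, List.map_map] at this
  exact this

/-- Elements of an algebra satisfying the defining relations give an algebra homomorphism. -/
def lift {A : Type*} [Ring A] [Algebra ℂ A] (f : B → A) (hq : ∀ s, f s * f s = -f s)
    (hb : ∀ s t, s ≠ t → M s t ≠ 0 →
      ((CoxeterSystem.alternatingWord s t (M s t)).map f).prod =
        ((CoxeterSystem.alternatingWord t s (M s t)).map f).prod) :
    ZeroHecke M →ₐ[ℂ] A :=
  RingQuot.liftAlgHom ℂ ⟨FreeAlgebra.lift ℂ f, by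
    rintro _ _ (⟨s⟩ | ⟨s, t, hst, hm⟩)
    · simpa using hq s
    · simpa [map_list_prod, Function.comp_def] using hb s t hst hm⟩

theorem lift_gen {A : Type*} [Ring A] [Algebra ℂ A] (f : B → A) (hq hb) (s : B) :
    lift (M := M) f hq hb (gen M s) = f s := by
  simp [lift, gen]

theorem induction {P : ZeroHecke M → Prop} (hc : ∀ c : ℂ, P (algebraMap ℂ _ c))
    (hg : ∀ s, P (gen M s)) (ha : ∀ a b, P a → P b → P (a + b))
    (hm : ∀ a b, P a → P b → P (a * b)) (a : ZeroHecke M) : P a := by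
  obtain ⟨x, rfl⟩ := RingQuot.mkAlgHom_surjective ℂ (HeckeRel M) a
  induction x using FreeAlgebra.induction with
  | grade0 c => simpa using hc c
  | grade1 s => exact hg s
  | mul a b h1 h2 => rw [map_mul]; exact hm _ _ h1 h2
  | add a b h1 h2 => rw [map_add]; exact ha _ _ h1 h2

open Classical in
theorem char_braid (I : Set B) (s t : B) (m : ℕ) (hm : 2 ≤ m) :
    ((CoxeterSystem.alternatingWord s t m).map (fun j => if j ∈ I then (-1 : ℂ) else 0)).prod =
      ((CoxeterSystem.alternatingWord t s m).map (fun j => if j ∈ I then (-1 : ℂ) else 0)).prod := by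
  obtain ⟨m, rfl⟩ : ∃ k, m = k + 2 := ⟨m - 2, by omega⟩
  by_cases hs : s ∈ I <;> by_cases ht : t ∈ I
  · have key : ∀ (k : ℕ) (a b : B), a ∈ I → b ∈ I →
        ((CoxeterSystem.alternatingWord a b k).map
          (fun j => if j ∈ I then (-1 : ℂ) else 0)).prod = (-1) ^ k := by
      intro k
      induction k with
      | zero => intro a b _ _; simp [CoxeterSystem.alternatingWord]
      | succ k ih =>
        intro a b ha hb
        simp [CoxeterSystem.alternatingWord, ih b a hb ha, hb, pow_succ]
    rw [key _ _ _ hs ht, key _ _ _ ht hs]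
  all_goals simp [CoxeterSystem.alternatingWord, hs, ht]

open Classical in
/-- The character of the one-dimensional module attached to `I`:
`π_j ↦ -1` if `j ∈ I` and `π_j ↦ 0` otherwise. -/
noncomputable def char (I : Set B) : ZeroHecke M →ₐ[ℂ] ℂ :=
  lift (fun j => if j ∈ I then -1 else 0) (fun s => by split <;> simp) fun s t hst h0 =>
    char_braid I s t _ (by have := M.off_diagonal s t hst; omega)

/-- The simple module `𝒮_I`, as an action on `ℂ` (with basis element `ε_I = 1`). -/
noncomputable def simpleRep (I : Set B) : ZeroHecke M →ₐ[ℂ] Module.End ℂ ℂ :=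
  (Algebra.lmul ℂ ℂ).comp (char I)

end ZeroHecke

end Hecke

section Grothendieck

/-- The defining relations `[A] - [B] + [C]` of the Grothendieck group, one for each short exact
sequence `0 → A → B → C → 0` of finitely generated modules. -/
def exactRelations (R : Type) [Ring R] : Set (FreeAbelianGroup (FGModuleCat.{0} R)) :=
  {z | ∃ (A B C : FGModuleCat.{0} R) (f : A →ₗ[R] B) (g : B →ₗ[R] C),
    Function.Injective f ∧ Function.Exact f g ∧ Function.Surjective g ∧
    z = FreeAbelianGroup.of A - FreeAbelianGroup.of B + FreeAbelianGroup.of C}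

/-- The Grothendieck group `𝒢₀(R)` of finitely generated `R`-modules. Isomorphic modules have the
same class, because of the exact sequences `0 → A → B → 0 → 0`. -/
abbrev G0 (R : Type) [Ring R] : Type 1 :=
  FreeAbelianGroup (FGModuleCat.{0} R) ⧸ AddSubgroup.closure (exactRelations R)

/-- The class `[M]` of a finitely generated module. -/
def G0.mk {R : Type} [Ring R] (M : FGModuleCat.{0} R) : G0 R :=
  QuotientAddGroup.mk (FreeAbelianGroup.of M)

theorem G0.mk_eq {R : Type} [Ring R] {A B C : FGModuleCat.{0} R} (f : A →ₗ[R] B)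
    (g : B →ₗ[R] C) (hf : Function.Injective f) (hfg : Function.Exact f g)
    (hg : Function.Surjective g) : G0.mk B = G0.mk A + G0.mk C := by
  have h : (QuotientAddGroup.mk (FreeAbelianGroup.of A - FreeAbelianGroup.of B +
      FreeAbelianGroup.of C) : G0 R) = 0 :=
    (QuotientAddGroup.eq_zero_iff _).2
      (AddSubgroup.subset_closure ⟨A, B, C, f, g, hf, hfg, hg, rfl⟩)
  have h' : G0.mk A - G0.mk B + G0.mk C = 0 := h
  rw [← sub_eq_zero, ← neg_eq_zero, ← h']
  abel

variable {A : Type} [Ring A] [Algebra ℂ A]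

/-- The `A`-module given by an action `ρ` of `A` on a finite-dimensional complex vector space. -/
def moduleOfRep {V : Type} [AddCommGroup V] [Module ℂ V] (ρ : A →ₐ[ℂ] Module.End ℂ V)
    (hV : Module.Finite ℂ V) : FGModuleCat.{0} A :=
  letI : Module A V := Module.compHom V ρ.toRingHom
  haveI : IsScalarTower ℂ A V := ⟨fun c a v => by
    change ρ (c • a) v = c • ρ a v
    rw [map_smul, LinearMap.smul_apply]⟩
  haveI : Module.Finite A V := Module.Finite.of_restrictScalars_finite ℂ A V
  FGModuleCat.of A V

theorem trace_of_exact {K U V W : Type*} [Field K] [AddCommGroup U] [Module K U]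
    [AddCommGroup V] [Module K V] [AddCommGroup W] [Module K W] [Module.Finite K U]
    [Module.Finite K V] [Module.Finite K W] (f : U →ₗ[K] V) (g : V →ₗ[K] W)
    (hf : Function.Injective f) (hfg : Function.Exact f g) (hg : Function.Surjective g)
    (a : Module.End K U) (b : Module.End K V) (c : Module.End K W)
    (hab : f ∘ₗ a = b ∘ₗ f) (hbc : g ∘ₗ b = c ∘ₗ g) :
    LinearMap.trace K V b = LinearMap.trace K U a + LinearMap.trace K W c := by
  obtain ⟨σ, hσ⟩ := g.exists_rightInverse_of_surjective (LinearMap.range_eq_top.2 hg)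
  obtain ⟨r, hr⟩ := f.exists_leftInverse_of_injective (LinearMap.ker_eq_bot.2 hf)
  set r' : V →ₗ[K] U := r ∘ₗ (LinearMap.id - σ ∘ₗ g) with hr'
  have hgf : g ∘ₗ f = 0 := LinearMap.ext fun x => hfg.apply_apply_eq_zero x
  have h1 : f ∘ₗ r' + σ ∘ₗ g = LinearMap.id := by
    ext x
    have hx : g (x - σ (g x)) = 0 := by
      rw [map_sub, ← LinearMap.comp_apply g σ, hσ]; simp
    obtain ⟨y, hy⟩ := (hfg _).1 hx
    have : r (f y) = y := LinearMap.congr_fun hr y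
    simp [hr', ← hy, this]
    rw [hy]
    abel
  have h2 : r' ∘ₗ f = LinearMap.id := by
    rw [hr', LinearMap.comp_assoc, LinearMap.sub_comp, LinearMap.comp_assoc, hgf]
    simpa using hr
  have h3 : b = (b ∘ₗ f) ∘ₗ r' + (b ∘ₗ σ) ∘ₗ g := by
    rw [LinearMap.comp_assoc, LinearMap.comp_assoc, ← LinearMap.comp_add, h1, LinearMap.comp_id]
  rw [h3, map_add, LinearMap.trace_comp_comm', LinearMap.trace_comp_comm' g (b ∘ₗ σ), ← hab,
    ← LinearMap.comp_assoc, h2, ← LinearMap.comp_assoc, hbc, LinearMap.comp_assoc, hσ,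
    LinearMap.id_comp, LinearMap.comp_id]

/-- The complex vector space structure of an `A`-module. -/
abbrev complexModule (A : Type) [Ring A] [Algebra ℂ A] (V : Type*) [AddCommGroup V] [Module A V] :
    Module ℂ V := Module.compHom V (algebraMap ℂ A)

theorem complexModule_tower (V : Type*) [AddCommGroup V] [Module A V] :
    let := complexModule A V
    IsScalarTower ℂ A V := by
  let := complexModule A V
  refine ⟨fun c a v => ?_⟩
  change (c • a) • v = algebraMap ℂ A c • a • v
  rw [Algebra.smul_def, mul_smul]

/-- The trace of `a : A` on an `A`-module. -/
noncomputable def traceOn (a : A) (V : Type*) [AddCommGroup V] [Module A V] : ℂ :=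
  letI := complexModule A V
  haveI := complexModule_tower (A := A) V
  LinearMap.trace ℂ V (Algebra.lsmul ℂ ℂ V a)

theorem complexModule_finite [Module.Finite ℂ A] (V : Type*) [AddCommGroup V] [Module A V]
    [Module.Finite A V] :
    let := complexModule A V
    Module.Finite ℂ V := by
  let := complexModule A V
  have := complexModule_tower (A := A) V
  exact Module.Finite.trans A V

theorem traceOn_exact [Module.Finite ℂ A] (a : A) {U V W : FGModuleCat.{0} A} (f : U →ₗ[A] V)
    (g : V →ₗ[A] W) (hf : Function.Injective f) (hfg : Function.Exact f g)
    (hg : Function.Surjective g) : traceOn a V = traceOn a U + traceOn a W := by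
  let := complexModule A U
  let := complexModule A V
  let := complexModule A W
  have := complexModule_tower (A := A) U
  have := complexModule_tower (A := A) V
  have := complexModule_tower (A := A) W
  have := complexModule_finite (A := A) U
  have := complexModule_finite (A := A) V
  have := complexModule_finite (A := A) W
  exact trace_of_exact (f.restrictScalars ℂ) (g.restrictScalars ℂ) hf hfg hg _ _ _
    (by ext x; simp) (by ext x; simp)

/-- The homomorphism on the Grothendieck group induced by the trace of `a`. -/
noncomputable def traceHom [Module.Finite ℂ A] (a : A) : G0 A →+ ℂ :=
  QuotientAddGroup.lift _ (FreeAbelianGroup.lift fun V : FGModuleCat.{0} A => traceOn a V) (by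
    rw [AddSubgroup.closure_le]
    rintro _ ⟨U, V, W, f, g, hf, hfg, hg, rfl⟩
    have := traceOn_exact a f g hf hfg hg
    simp [this])

theorem traceHom_mk [Module.Finite ℂ A] (a : A) (V : FGModuleCat.{0} A) :
    traceHom a (G0.mk V) = traceOn a V := by
  simp [traceHom, G0.mk]

end Grothendieck

section TypeBSpecific

variable {n : ℕ}

/-- Extension of a family indexed by `Fin n` to all natural indices. -/
def extend {G : Type*} [Monoid G] (f : Fin n → G) (i : ℕ) : G :=
  if h : i < n then f ⟨i, h⟩ else 1

theorem extend_of_lt {G : Type*} [Monoid G] (f : Fin n → G) {i : ℕ} (h : i < n) :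
    extend f i = f ⟨i, h⟩ := dif_pos h

theorem chainRel_extend {G : Type*} [Monoid G] (f : Fin n → G)
    (hsq : ∀ i, f i * f i = 1 ∨ f i * f i = f i)
    (hb : ∀ i j, i ≠ j → ((CoxeterSystem.alternatingWord i j (matrixB n i j)).map f).prod =
      ((CoxeterSystem.alternatingWord j i (matrixB n i j)).map f).prod) :
    ChainRel (extend f) n where
  sq i hi := by rw [extend_of_lt f hi]; exact hsq _
  comm i j hij hj := by
    have hi : i < n := by omega
    rw [extend_of_lt f hi, extend_of_lt f hj]
    have hM : matrixB n ⟨i, hi⟩ ⟨j, hj⟩ = 2 := by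
      rw [matrixB_apply, if_neg (by simp; omega), if_neg (by simp; omega)]
    have := hb ⟨i, hi⟩ ⟨j, hj⟩ (by simp; omega)
    rw [hM] at this
    simpa [CoxeterSystem.alternatingWord] using this
  braid i h1 hi := by
    have hi' : i < n := by omega
    rw [extend_of_lt f hi, extend_of_lt f hi']
    have hM : matrixB n ⟨i, hi'⟩ ⟨i + 1, hi⟩ = 3 := by
      rw [matrixB_apply, if_neg (by simp), if_pos (by simp), if_neg (by simp; omega)]
    have := hb ⟨i, hi'⟩ ⟨i + 1, hi⟩ (by simp)
    rw [hM] at this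
    simpa [CoxeterSystem.alternatingWord, mul_assoc] using this.symm
  four h1 := by
    have h0 : 0 < n := by omega
    rw [extend_of_lt f h0, extend_of_lt f h1]
    have hM : matrixB n ⟨0, h0⟩ ⟨1, h1⟩ = 4 := by
      rw [matrixB_apply, if_neg (by simp), if_pos (by simp), if_pos (by simp)]
    have := hb ⟨0, h0⟩ ⟨1, h1⟩ (by simp)
    rw [hM] at this
    simpa [CoxeterSystem.alternatingWord, mul_assoc] using this

theorem finite_closure_range {G : Type*} [Monoid G] (f : Fin n → G)
    (H : ChainRel (extend f) n) : (Submonoid.closure (Set.range f) : Set G).Finite := by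
  have h := finite_closure H n le_rfl
  convert h using 3
  ext x
  constructor
  · rintro ⟨i, rfl⟩
    exact ⟨i, i.2, extend_of_lt f i.2⟩
  · rintro ⟨i, hi, rfl⟩
    exact ⟨⟨i, hi⟩, (extend_of_lt f hi).symm⟩

/-- The hyperoctahedral group is finite. -/
theorem finite_group {W : Type*} [Group W] (cs : CoxeterSystem (matrixB n) W) : Finite W := by
  have H : ChainRel (extend cs.simple) n := chainRel_extend _
    (fun i => Or.inl (cs.simple_mul_simple_self i)) (fun i j _ => by
      have := cs.wordProd_braidWord_eq i j
      rw [CoxeterSystem.braidWord, CoxeterSystem.braidWord, (matrixB n).symmetric j i] at this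
      exact this)
  have := finite_closure_range _ H
  rw [cs.submonoid_closure_range_simple] at this
  exact Set.finite_univ_iff.1 this

theorem chainRel_neg {A : Type*} [Ring A] (f : Fin n → A) (hq : ∀ i, f i * f i = -f i)
    (hb : ∀ i j, i ≠ j → ((CoxeterSystem.alternatingWord i j (matrixB n i j)).map f).prod =
      ((CoxeterSystem.alternatingWord j i (matrixB n i j)).map f).prod) :
    ChainRel (extend fun i => -f i) n := by
  have key : ∀ l : List (Fin n),
      (l.map fun i => -f i).prod = (-1) ^ l.length * (l.map f).prod := by
    intro l
    induction l with
    | nil => simp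
    | cons a l ih =>
      rw [List.map_cons, List.prod_cons, ih, List.map_cons, List.prod_cons, List.length_cons,
        pow_succ', neg_mul, ← mul_assoc, ← ((Commute.neg_one_left (f a)).pow_left _).eq]
      simp [mul_assoc]
  refine chainRel_extend _ (fun i => Or.inr (by simp [hq])) fun i j hij => ?_
  rw [key, key, hb i j hij]
  simp

theorem matrixB_ne_zero (i j : Fin n) : matrixB n i j ≠ 0 := by
  rw [matrixB_apply]
  split_ifs <;> simp

/-- The type-`B` `0`-Hecke algebra `H_n^B(0)`. -/
abbrev HeckeB (n : ℕ) : Type := ZeroHecke (matrixB n)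

instance : Module.Finite ℂ (HeckeB n) := by
  have H : ChainRel (extend fun i => -ZeroHecke.gen (matrixB n) i) n :=
    chainRel_neg _ ZeroHecke.gen_sq fun i j hij => ZeroHecke.gen_braid i j hij (matrixB_ne_zero i j)
  have hfin := finite_closure_range _ H
  set N := Submonoid.closure (Set.range fun i => -ZeroHecke.gen (matrixB n) i) with hN
  have htop : Submodule.span ℂ (N : Set (HeckeB n)) = ⊤ := by
    rw [eq_top_iff]
    rintro a -
    rw [hN, ← Algebra.adjoin_eq_span, Subalgebra.mem_toSubmodule]
    induction a using ZeroHecke.induction with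
    | hc c => exact Subalgebra.algebraMap_mem _ c
    | hg s =>
      rw [← neg_neg (ZeroHecke.gen _ s)]
      exact Subalgebra.neg_mem _ (Algebra.subset_adjoin ⟨s, rfl⟩)
    | ha a b h1 h2 => exact Subalgebra.add_mem _ h1 h2
    | hm a b h1 h2 => exact Subalgebra.mul_mem _ h1 h2
  exact ⟨⟨hfin.toFinset, by simpa using htop⟩⟩

/-- The class `[𝒮_I^B]` of the simple `H_n^B(0)`-module indexed by `I ⊆ {0, …, n-1}`. -/
noncomputable def simpleClass (I : Set (Fin n)) : G0 (HeckeB n) :=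
  G0.mk (moduleOfRep (ZeroHecke.simpleRep I) inferInstance)

/-- The type-`B` fundamental quasisymmetric function `F^B_I` of degree `n`, for
`I ⊆ {0, …, n-1}`, as a power series in `x_0, x_1, x_2, …`: the coefficient of a monomial is the
number of sequences `0 = i_0 ≤ i_1 ≤ ⋯ ≤ i_n`, with `i_j < i_{j+1}` for `j ∈ I`, for which
`x_{i_1} ⋯ x_{i_n}` is this monomial. -/
noncomputable def fundamentalB (n : ℕ) (I : Set (Fin n)) : MvPowerSeries ℕ ℂ := fun d =>
  (Set.ncard {i : Fin (n + 1) → ℕ | i 0 = 0 ∧ Monotone i ∧ (∀ j ∈ I, i j.castSucc < i j.succ) ∧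
    ∑ j : Fin n, Finsupp.single (i j.succ) 1 = d} : ℂ)

open Classical in
/-- An element whose trace on `𝒮_J^B` is `1` if `I = J` and `0` otherwise. -/
noncomputable def dualElement (I : Set (Fin n)) : HeckeB n :=
  (List.ofFn fun i => if i ∈ I then -ZeroHecke.gen (matrixB n) i
    else 1 + ZeroHecke.gen (matrixB n) i).prod

open Classical in
theorem char_dualElement (I J : Set (Fin n)) :
    ZeroHecke.char J (dualElement I) = if I = J then 1 else 0 := by
  rw [dualElement, map_list_prod, List.map_ofFn, List.prod_ofFn]
  have : ∀ i, (ZeroHecke.char J ∘ fun i => if i ∈ I then -ZeroHecke.gen (matrixB n) i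
      else 1 + ZeroHecke.gen (matrixB n) i) i = if (i ∈ I ↔ i ∈ J) then 1 else 0 := by
    intro i
    by_cases hI : i ∈ I <;> by_cases hJ : i ∈ J <;>
      simp [hI, hJ, ZeroHecke.char, ZeroHecke.lift_gen]
  simp_rw [this]
  rw [Finset.prod_ite_zero]
  simp [Set.ext_iff]

theorem traceHom_simpleClass (a : HeckeB n) (J : Set (Fin n)) :
    traceHom a (simpleClass J) = ZeroHecke.char J a := by
  rw [simpleClass, traceHom_mk]
  set V := moduleOfRep (A := HeckeB n) (ZeroHecke.simpleRep J) inferInstance with hV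
  let := complexModule (HeckeB n) V
  have := complexModule_tower (A := HeckeB n) V
  have hsm : ∀ (a : HeckeB n) (x : ℂ), (a • (show V from x) : V) =
    (show V from ZeroHecke.char J a * x) := fun a x => rfl
  have h1 : (Algebra.lsmul ℂ ℂ V a : V →ₗ[ℂ] V) = ZeroHecke.char J a • LinearMap.id := by
    ext x
    change a • x = algebraMap ℂ (HeckeB n) (ZeroHecke.char J a) • x
    rw [hsm a x, hsm _ x, AlgHom.commutes]
    rfl
  have h2 : Module.finrank ℂ V = 1 := by
    refine finrank_eq_one (show V from (1 : ℂ)) (one_ne_zero (α := ℂ)) fun w => ⟨(show ℂ from w), ?_⟩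
    change (ZeroHecke.char J (algebraMap ℂ (HeckeB n) (show ℂ from w)) * 1 : ℂ) = w
    rw [AlgHom.commutes]
    exact mul_one (show ℂ from w)
  have := complexModule_finite (A := HeckeB n) V
  change LinearMap.trace ℂ V (Algebra.lsmul ℂ ℂ V a) = _
  rw [h1, map_smul, LinearMap.trace_id, h2]
  simp

theorem exists_characteristic (n : ℕ) : ∃ ch : G0 (HeckeB n) →+ MvPowerSeries ℕ ℂ,
    ∀ I, ch (simpleClass I) = fundamentalB n I := by
  classical
  refine ⟨∑ I : Set (Fin n), ((AddMonoidHom.flip (smulAddHom ℂ (MvPowerSeries ℕ ℂ))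
    (fundamentalB n I)).comp (traceHom (dualElement I))), fun J => ?_⟩
  simp [traceHom_simpleClass, char_dualElement]

theorem mk_mem_closure : ∀ (d : ℕ) (V : FGModuleCat.{0} (HeckeB n)),
    (let := complexModule (HeckeB n) V; Module.finrank ℂ V = d) →
    G0.mk V ∈ AddSubgroup.closure (Set.range (simpleClass (n := n))) := by
  classical
  intro d
  induction d using Nat.strong_induction_on with
  | _ d ih =>
  intro V hd
  let := complexModule (HeckeB n) V
  have := complexModule_tower (A := HeckeB n) V
  have := complexModule_finite (A := HeckeB n) V
  rcases subsingleton_or_nontrivial V with hV | hV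
  · have h : G0.mk V = G0.mk V + G0.mk V :=
      G0.mk_eq (LinearMap.id : V →ₗ[HeckeB n] V) (0 : V →ₗ[HeckeB n] V)
        (fun _ _ _ => Subsingleton.elim _ _)
        (fun x => ⟨fun _ => ⟨x, rfl⟩, fun _ => rfl⟩) (fun x => ⟨x, Subsingleton.elim _ _⟩)
    rw [left_eq_add.1 h]
    exact AddSubgroup.zero_mem _
  · have hq : ∀ i, (Algebra.lsmul ℂ ℂ V (ZeroHecke.gen (matrixB n) i)) *
        (Algebra.lsmul ℂ ℂ V (ZeroHecke.gen (matrixB n) i)) =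
        -(Algebra.lsmul ℂ ℂ V (ZeroHecke.gen (matrixB n) i)) := by
      intro i
      rw [← map_mul, ZeroHecke.gen_sq, map_neg]
    have H := chainRel_neg (fun i => Algebra.lsmul ℂ ℂ V (ZeroHecke.gen (matrixB n) i)) hq
      (fun i j hij => by
        have := congrArg (Algebra.lsmul ℂ ℂ V)
          (ZeroHecke.gen_braid (M := matrixB n) i j hij (matrixB_ne_zero i j))
        simp only [map_list_prod, List.map_map] at this
        exact this)
    obtain ⟨v, hv, hev⟩ := exists_eigenvector H (fun i hi => by
      rw [extend_of_lt _ hi, neg_mul_neg, hq]) n le_rfl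
    let I : Set (Fin n) := {i | ZeroHecke.gen (matrixB n) i • v = -v}
    have hgen : ∀ i, ZeroHecke.gen (matrixB n) i • v =
        ZeroHecke.char I (ZeroHecke.gen (matrixB n) i) • v := by
      intro i
      rw [ZeroHecke.char, ZeroHecke.lift_gen]
      by_cases hi : i ∈ I
      · have hi' : ZeroHecke.gen (matrixB n) i • v = -v := hi
        rw [if_pos hi, neg_one_smul, hi']
      · rw [if_neg hi, zero_smul]
        obtain ⟨c, hc⟩ := hev i i.2
        rw [extend_of_lt _ i.2] at hc
        have hc : ZeroHecke.gen (matrixB n) i • v = (-c) • v := by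
          rw [neg_smul, ← hc]; simp
        have h2 : ZeroHecke.gen (matrixB n) i • ZeroHecke.gen (matrixB n) i • v =
            -(ZeroHecke.gen (matrixB n) i • v) := by
          rw [← mul_smul, ZeroHecke.gen_sq, neg_smul]
        rw [hc, smul_comm, hc, ← sub_eq_zero, ← neg_smul, smul_smul, ← sub_smul,
          smul_eq_zero_iff_left hv] at h2
        have hc1 : c ≠ 1 := by
          rintro rfl
          exact hi (by change _ = _; rw [hc, neg_one_smul])
        have hc0 : c = 0 := by
          have : c * (c - 1) = 0 := by linear_combination h2
          rcases mul_eq_zero.1 this with h | h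
          · exact h
          · exact absurd (sub_eq_zero.1 h) hc1
        rw [hc, hc0, neg_zero, zero_smul]
    have hact : ∀ a : HeckeB n, a • v = ZeroHecke.char I a • v := by
      intro a
      induction a using ZeroHecke.induction with
      | hc c => rw [AlgHom.commutes]; rfl
      | hg s => exact hgen s
      | ha a b h1 h2 => rw [add_smul, h1, h2, map_add, add_smul]
      | hm a b h1 h2 => rw [mul_smul, h2, smul_comm, h1, map_mul, mul_comm, mul_smul]
    let S := moduleOfRep (A := HeckeB n) (ZeroHecke.simpleRep I) inferInstance
    let f : S →ₗ[HeckeB n] V :=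
      { toFun := fun z => (show ℂ from z) • v
        map_add' := fun x y => add_smul (show ℂ from x) (show ℂ from y) v
        map_smul' := fun a x => by
          change (ZeroHecke.char I a * (show ℂ from x)) • v = a • (show ℂ from x) • v
          rw [smul_comm, hact, smul_smul, mul_comm] }
    have hf : Function.Injective f := fun x y hxy => smul_left_injective ℂ hv hxy
    let N : Submodule (HeckeB n) V := LinearMap.range f
    let Q : FGModuleCat.{0} (HeckeB n) := FGModuleCat.of (HeckeB n) (V ⧸ N)
    have hmk : G0.mk V = simpleClass I + G0.mk Q :=
      G0.mk_eq (C := Q) f N.mkQ hf (LinearMap.exact_map_mkQ_range f) N.mkQ_surjective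
    rw [hmk]
    refine AddSubgroup.add_mem _ (AddSubgroup.subset_closure ⟨I, rfl⟩) (ih _ ?_ Q rfl)
    let := complexModule (HeckeB n) (V ⧸ N)
    have := complexModule_tower (A := HeckeB n) (V ⧸ N)
    have := complexModule_finite (A := HeckeB n) (V ⧸ N)
    rw [← hd]
    change Module.finrank ℂ (V ⧸ N) < _
    have hle := LinearMap.finrank_range_add_finrank_ker (N.mkQ.restrictScalars ℂ)
    have hr : LinearMap.range (N.mkQ.restrictScalars ℂ) = ⊤ :=
      LinearMap.range_eq_top.2 N.mkQ_surjective
    have hker : 0 < Module.finrank ℂ (LinearMap.ker (N.mkQ.restrictScalars ℂ)) := by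
      rw [Module.finrank_pos_iff_exists_ne_zero]
      refine ⟨⟨v, ?_⟩, fun h => hv (congrArg Subtype.val h)⟩
      rw [LinearMap.mem_ker]
      change N.mkQ v = 0
      rw [Submodule.mkQ_apply, Submodule.Quotient.mk_eq_zero]
      exact ⟨(show S from (1 : ℂ)), one_smul ℂ v⟩
    rw [hr, finrank_top] at hle
    omega

/-- There is exactly one homomorphism on `𝒢₀(H_n^B(0))` that sends `[𝒮_I^B]` to `F^B_I` for
all `I`. -/
theorem existsUnique_characteristic (n : ℕ) : ∃! ch : G0 (HeckeB n) →+ MvPowerSeries ℕ ℂ,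
    ∀ I, ch (simpleClass I) = fundamentalB n I := by
  obtain ⟨ch, hch⟩ := exists_characteristic n
  refine ⟨ch, hch, fun ch' hch' => ?_⟩
  have hcl : AddSubgroup.closure (Set.range (simpleClass (n := n))) = ⊤ := by
    rw [eq_top_iff]
    rintro x -
    obtain ⟨z, rfl⟩ := QuotientAddGroup.mk_surjective x
    induction z using FreeAbelianGroup.induction_on with
    | zero => exact AddSubgroup.zero_mem _
    | of V => exact mk_mem_closure _ V rfl
    | neg V h => exact AddSubgroup.neg_mem _ h
    | add x y hx hy => exact AddSubgroup.add_mem _ hx hy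
  refine AddMonoidHom.eq_of_eqOn_dense hcl ?_
  rintro _ ⟨I, rfl⟩
  rw [hch, hch']

/-- The type-`B` quasisymmetric characteristic `ch^B`: the unique homomorphism on `𝒢₀(H_n^B(0))`
with `ch^B([𝒮_I^B]) = F^B_I` for all `I ⊆ {0, …, n-1}`. -/
noncomputable def chB (n : ℕ) : G0 (HeckeB n) →+ MvPowerSeries ℕ ℂ :=
  (existsUnique_characteristic n).choose

theorem chB_simpleClass (I : Set (Fin n)) : chB n (simpleClass I) = fundamentalB n I :=
  (existsUnique_characteristic n).choose_spec.1 I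

end TypeBSpecific

section AscentCompatible

variable {B W : Type} [Group W] {M : CoxeterMatrix B} (cs : CoxeterSystem M W)

/-- The set of (left) descents of `w`. -/
def Des (w : W) : Set B := {s | cs.IsLeftDescent w s}

/-- The quadruple `(u, v, s, t)` is aligned. -/
def Aligned (u v : W) (s t : B) : Prop :=
  s ∉ Des cs u ∧ t ∉ Des cs v ∧ u⁻¹ * cs.simple s * u = v⁻¹ * cs.simple t * v

/-- Ascent-compatible subsets of a Coxeter group. -/
def AscentCompatible (X : Set W) : Prop :=
  ∀ u ∈ X, ∀ v ∈ X, ∀ s t : B, Aligned cs u v s t →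
    (cs.simple s * u ∈ X ↔ cs.simple t * v ∈ X)

open Classical in
/-- The linear operator `π_s` on `ℂX`. -/
noncomputable def piOp (X : Set W) (s : B) : Module.End ℂ (X →₀ ℂ) :=
  Finsupp.linearCombination ℂ fun x : X =>
    if s ∈ Des cs (x : W) then -Finsupp.single x 1
    else if h : cs.simple s * (x : W) ∈ X then Finsupp.single ⟨cs.simple s * (x : W), h⟩ 1
    else 0

end AscentCompatible

/-- `ℂX` is finite-dimensional for every subset `X` of the hyperoctahedral group. -/
theorem finite_free {n : ℕ} {W : Type} [Group W] (cs : CoxeterSystem (matrixB n) W) (X : Set W) :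
    Module.Finite ℂ (X →₀ ℂ) := by
  have := finite_group cs
  infer_instance

end TypeB

open CoxeterSystem

namespace TypeB

/-! ### Exchange property from the action on signed reflections. -/

section Exchange

/-! The content lies in the braid relations. Fix generators s, t and let d be the order of the
product of the two simple reflections. Every coset of the dihedral subgroup they generate contains
an element u of minimal length, and its elements are u multiplied on the left by alternating words
of at most d letters. By the exchange property, both alternating chains starting at u ascend at each
of their d steps (`not_isLeftDescent_alternatingWord`), and they meet at a common top, where s and t
are both descents.

An alternating product of operators applied to u follows one chain. It gives 0 if the chain leaves
X, and otherwise the top, with one sign for each surplus factor. The steps of the two chains are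
right multiplications by the same reflections in opposite order (`conj_alternatingWord_swap`). So
ascent-compatibility transfers membership in X between the chains: one lies in X if and only if the
other does (`climb_mem_of_climb_mem`), and the two products agree at u. Elsewhere in the coset one
of the two letters is a descent; the product that starts with it first gives a sign and then
performs the same climb as the other product (`piAlternating_swap_of_mem_Des`). Only d ≤ m(s,t) is
needed, which follows from divisibility, not equality.

For the characteristic, the action is triangular with respect to length, with the character of
Des(x) as the diagonal entry at x (`ascentRep_apply_of_length_le`). Hence traces on ℂX are sums of
these characters. Since `chB` is an explicit combination of the traces of the dual elements
(`chB_apply`), each x contributes exactly the fundamental function of its descent set. -/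

theorem functionEnd_mul_apply {α : Type*} (f g : Function.End α) (x : α) :
    (f * g) x = f (g x) := rfl

theorem functionEnd_one_apply {α : Type*} (x : α) : (1 : Function.End α) x = x := rfl

variable {B W : Type*} [Group W] {M : CoxeterMatrix B} (cs : CoxeterSystem M W)

open Classical in
/-- The action of `s_i` on pairs of a group element and a sign: conjugation by `s_i`, with a change
of sign at `s_i`. -/
noncomputable def signedConj (i : B) : Function.End (W × ZMod 2) := fun p =>
  (cs.simple i * p.1 * cs.simple i, p.2 + if p.1 = cs.simple i then 1 else 0)

open Classical in
-- Each of the 2k letters flips the sign at exactly one group element; pulled back to the start,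
-- these elements are the products of `cs.simple j` with successive powers of the rotation.
theorem signedConj_mul_pow (i j : B) (k : ℕ) (p : W × ZMod 2) :
    ((signedConj cs i * signedConj cs j) ^ k) p =
      ((cs.simple i * cs.simple j) ^ k * p.1 * ((cs.simple i * cs.simple j) ^ k)⁻¹,
        p.2 + ∑ q ∈ Finset.range (2 * k),
          if p.1 = cs.simple j * (cs.simple i * cs.simple j) ^ q then 1 else 0) := by
  induction k with
  | zero => simp [functionEnd_one_apply]
  | succ k ih =>
    set c := cs.simple i * cs.simple j with hc
    have hcj : cs.simple j * c * cs.simple j = c⁻¹ := by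
      rw [hc, mul_inv_rev, inv_simple, inv_simple]
      simp [mul_assoc]
    have hpow : ∀ q : ℕ, cs.simple j * c ^ q * cs.simple j = (c ^ q)⁻¹ := by
      intro q
      have := conj_pow (i := q) (a := cs.simple j) (b := c)
      rw [inv_simple, hcj] at this
      rw [← this, inv_pow]
    have hpow' : ∀ q : ℕ, (c ^ q)⁻¹ * cs.simple j = cs.simple j * c ^ q := by
      intro q
      rw [← hpow]
      simp
    have e1 : c ^ k * p.1 * (c ^ k)⁻¹ = cs.simple j ↔ p.1 = cs.simple j * c ^ (2 * k) := by
      rw [mul_inv_eq_iff_eq_mul, ← eq_inv_mul_iff_mul_eq, ← mul_assoc, hpow', mul_assoc, ← pow_add,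
        two_mul]
    have e2 : cs.simple j * (c ^ k * p.1 * (c ^ k)⁻¹) * cs.simple j = cs.simple i ↔
        p.1 = cs.simple j * c ^ (2 * k + 1) := by
      have h3 : cs.simple j * (c ^ k * p.1 * (c ^ k)⁻¹) * cs.simple j = cs.simple i ↔
          c ^ k * p.1 * (c ^ k)⁻¹ = cs.simple j * c := by
        rw [hc, ← mul_left_cancel_iff (a := cs.simple j), ← mul_right_cancel_iff (a := cs.simple j)]
        simp [mul_assoc]
      rw [h3, mul_inv_eq_iff_eq_mul, ← eq_inv_mul_iff_mul_eq, mul_assoc, ← mul_assoc, hpow',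
        mul_assoc, ← pow_succ', ← pow_add]
      ring_nf
    rw [pow_succ', functionEnd_mul_apply, ih, functionEnd_mul_apply,
      signedConj, signedConj, mul_add, Finset.sum_range_succ,
      Finset.sum_range_succ]
    simp only [e1, e2]
    refine Prod.ext ?_ (by simp only [add_assoc])
    simp only [pow_succ', mul_inv_rev, hc, inv_simple, mul_assoc]

theorem isLiftable_signedConj : M.IsLiftable (signedConj cs) := by
  classical
  intro i j
  funext p
  rw [signedConj_mul_pow, simple_mul_simple_pow, two_mul, Finset.sum_range_add]
  simp only [pow_add, simple_mul_simple_pow, one_mul]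
  -- The rotation has trivial `M i j`-th power, so the two halves of the list of flips coincide and
  -- cancel modulo 2.
  rw [CharTwo.add_self_eq_zero]
  simp [functionEnd_one_apply]

open Classical in
theorem lift_signedConj_wordProd (ω : List B) (p : W × ZMod 2) :
    cs.lift ⟨signedConj cs, isLiftable_signedConj cs⟩ (cs.wordProd ω) p =
      (cs.wordProd ω * p.1 * (cs.wordProd ω)⁻¹, p.2 + ((cs.rightInvSeq ω).count p.1 : ZMod 2)) := by
  induction ω with
  | nil => simp [functionEnd_one_apply]
  | cons i ω ih =>
    rw [wordProd_cons, map_mul, functionEnd_mul_apply, ih, lift_apply_simple,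
      signedConj, rightInvSeq, List.count_cons]
    refine Prod.ext (by simp [mul_assoc]) ?_
    have : cs.wordProd ω * p.1 * (cs.wordProd ω)⁻¹ = cs.simple i ↔
        (cs.wordProd ω)⁻¹ * cs.simple i * cs.wordProd ω = p.1 := by
      constructor <;> intro h
      · rw [← h]; group
      · rw [← h]; group
    simp [this, add_assoc]

open Classical in
-- The lifted action depends on the group element alone, and its sign component records this parity.
theorem count_rightInvSeq_of_wordProd_eq {ω ω' : List B} (h : cs.wordProd ω = cs.wordProd ω')
    (t : W) : ((cs.rightInvSeq ω).count t : ZMod 2) = (cs.rightInvSeq ω').count t := by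
  have h1 := lift_signedConj_wordProd cs ω (t, 0)
  rw [h, lift_signedConj_wordProd] at h1
  simpa using (congrArg Prod.snd h1).symm

/-- The exchange property: a left descent of the product of a word deletes a letter of the word. -/
theorem conj_mem_rightInvSeq_of_isLeftDescent {i : B} {ω : List B}
    (h : cs.IsLeftDescent (cs.wordProd ω) i) :
    (cs.wordProd ω)⁻¹ * cs.simple i * cs.wordProd ω ∈ cs.rightInvSeq ω := by
  classical
  obtain ⟨ρ, hρ, e⟩ := cs.exists_isReduced (cs.simple i * cs.wordProd ω)
  have hprod : cs.wordProd (i :: ρ) = cs.wordProd ω := by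
    rw [wordProd_cons, ← e, simple_mul_simple_cancel_left]
  have hred : cs.IsReduced (i :: ρ) := by
    have h1 := cs.isLeftDescent_iff.1 h
    rw [CoxeterSystem.IsReduced, hprod, List.length_cons, ← hρ.eq, ← e, h1]
  have hmem : (cs.wordProd ω)⁻¹ * cs.simple i * cs.wordProd ω ∈ cs.rightInvSeq (i :: ρ) := by
    rw [rightInvSeq, ← e]
    simp [mul_assoc]
  have hc := count_rightInvSeq_of_wordProd_eq cs hprod
    ((cs.wordProd ω)⁻¹ * cs.simple i * cs.wordProd ω)
  -- A reduced word beginning with i has this reflection as the head of a duplicate-free sequence.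
  -- The count there is 1, so it is odd for every word of the same product.
  rw [List.count_eq_one_of_mem hred.nodup_rightInvSeq hmem] at hc
  by_contra hne
  rw [List.count_eq_zero_of_not_mem hne] at hc
  simp at hc

theorem mem_rightInvSeq_append {ω ρ : List B} {t : W} (h : t ∈ cs.rightInvSeq (ω ++ ρ)) :
    cs.wordProd ρ * t * (cs.wordProd ρ)⁻¹ ∈ cs.rightInvSeq ω ∨ t ∈ cs.rightInvSeq ρ := by
  induction ω with
  | nil => exact Or.inr h
  | cons i ω ih =>
    rw [List.cons_append, rightInvSeq, List.mem_cons] at h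
    rcases h with h | h
    · left
      rw [rightInvSeq, List.mem_cons]
      left
      rw [h, wordProd_append]
      group
    · rcases ih h with h | h
      · exact Or.inl (List.mem_cons_of_mem _ h)
      · exact Or.inr h

end Exchange

/-! ### Alternating words and cosets of dihedral parabolic subgroups. -/

section Dihedral

variable {B W : Type*} [Group W] {M : CoxeterMatrix B} (cs : CoxeterSystem M W)

theorem wordProd_alternatingWord_succ (s t : B) (k : ℕ) :
    cs.wordProd (alternatingWord s t (k + 1)) =
      cs.simple (if Even k then t else s) * cs.wordProd (alternatingWord s t k) := by
  rw [alternatingWord_succ', wordProd_cons]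

/-- Identifies the reflection by which the next step of an alternating chain multiplies on the
right. Removing the last letter conjugates by it and exchanges s and t, which gives the induction.
-/
theorem conj_alternatingWord (s t : B) (k : ℕ) :
    (cs.wordProd (alternatingWord s t k))⁻¹ * cs.simple (if Even k then t else s) *
      cs.wordProd (alternatingWord s t k) = cs.simple t * (cs.simple s * cs.simple t) ^ k := by
  induction k generalizing s t with
  | zero => simp [alternatingWord]
  | succ k ih =>
    have e : (if Even (k + 1) then t else s) = if Even k then s else t := by
      by_cases hk : Even k <;> simp [hk, Nat.even_add_one, -Nat.not_even_iff_odd]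
    rw [alternatingWord_succ, wordProd_concat, mul_inv_rev, inv_simple, e]
    calc _ = cs.simple t * ((cs.wordProd (alternatingWord t s k))⁻¹ *
            cs.simple (if Even k then s else t) * cs.wordProd (alternatingWord t s k)) *
            cs.simple t := by simp only [mul_assoc]
      _ = _ := by
        rw [ih, pow_succ]
        have : (cs.simple s * (cs.simple t * cs.simple s) ^ k) * cs.simple t =
            (cs.simple s * cs.simple t) ^ k * (cs.simple s * cs.simple t) := by
          rw [← mul_pow_mul, mul_assoc]
        rw [mul_assoc, this]

theorem wordProd_alternatingWord_swap (s t : B) (k : ℕ) :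
    cs.wordProd (alternatingWord t s k) =
      cs.wordProd (alternatingWord s t k) * (cs.simple t * cs.simple s) ^ k := by
  induction k generalizing s t with
  | zero => simp [alternatingWord]
  | succ k ih =>
    rw [alternatingWord_succ, wordProd_concat, alternatingWord_succ, wordProd_concat, ih t s,
      pow_succ', mul_assoc, mul_assoc, mul_pow_mul]
    simp [mul_assoc]

theorem simple_mul_simple_pow_orderOf (s t : B) :
    (cs.simple t * cs.simple s) ^ orderOf (cs.simple s * cs.simple t) = 1 := by
  have : cs.simple t * cs.simple s = (cs.simple s * cs.simple t)⁻¹ := by simp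
  rw [this, inv_pow, pow_orderOf_eq_one, inv_one]

theorem orderOf_simple_mul_simple_comm (s t : B) :
    orderOf (cs.simple s * cs.simple t) = orderOf (cs.simple t * cs.simple s) := by
  have : cs.simple t * cs.simple s = (cs.simple s * cs.simple t)⁻¹ := by simp
  rw [this, orderOf_inv]

theorem wordProd_alternatingWord_orderOf (s t : B) :
    cs.wordProd (alternatingWord t s (orderOf (cs.simple s * cs.simple t))) =
      cs.wordProd (alternatingWord s t (orderOf (cs.simple s * cs.simple t))) := by
  rw [wordProd_alternatingWord_swap, simple_mul_simple_pow_orderOf, mul_one]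

/-- The steps of the two alternating chains are the same reflections in opposite order. -/
theorem conj_alternatingWord_swap (s t : B) {k l : ℕ}
    (h : k + l + 1 = orderOf (cs.simple s * cs.simple t)) :
    cs.simple t * (cs.simple s * cs.simple t) ^ k =
      cs.simple s * (cs.simple t * cs.simple s) ^ l := by
  have h1 : (cs.simple s * cs.simple t) ^ (k + 1) * (cs.simple s * cs.simple t) ^ l = 1 := by
    rw [← pow_add, ← pow_orderOf_eq_one (cs.simple s * cs.simple t), ← h]
    congr 1
    omega
  have h2 : cs.simple t * cs.simple s = (cs.simple s * cs.simple t)⁻¹ := by simp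
  rw [h2, inv_pow, ← eq_inv_of_mul_eq_one_left h1, pow_succ', ← mul_assoc, ← mul_assoc,
    simple_mul_simple_self, one_mul]

theorem mem_rightInvSeq_alternatingWord {s t : B} {k : ℕ} {x : W}
    (h : x ∈ cs.rightInvSeq (alternatingWord s t k)) :
    ∃ j < k, x = cs.simple t * (cs.simple s * cs.simple t) ^ j := by
  induction k with
  | zero => simp [alternatingWord] at h
  | succ k ih =>
    rw [alternatingWord_succ', rightInvSeq, List.mem_cons, conj_alternatingWord] at h
    rcases h with h | h
    · exact ⟨k, by omega, h⟩
    · obtain ⟨j, hj, e⟩ := ih h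
      exact ⟨j, by omega, e⟩

/-- The alternating chains above a shortest element of a coset of a dihedral parabolic subgroup
go up. -/
theorem not_isLeftDescent_alternatingWord {s t : B} {u : W}
    (hu : ∀ g ∈ Subgroup.closure {cs.simple s, cs.simple t}, cs.length u ≤ cs.length (g * u))
    {k : ℕ} (hk : k < orderOf (cs.simple s * cs.simple t)) :
    ¬ cs.IsLeftDescent (cs.wordProd (alternatingWord s t k) * u) (if Even k then t else s) := by
  intro h
  obtain ⟨ρ, hρ, rfl⟩ := cs.exists_isReduced u
  rw [← wordProd_append] at h
  have h1 := conj_mem_rightInvSeq_of_isLeftDescent cs h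
  have e : (cs.wordProd (alternatingWord s t k ++ ρ))⁻¹ * cs.simple (if Even k then t else s) *
      cs.wordProd (alternatingWord s t k ++ ρ) =
      (cs.wordProd ρ)⁻¹ * (cs.simple t * (cs.simple s * cs.simple t) ^ k) * cs.wordProd ρ := by
    rw [← conj_alternatingWord, wordProd_append]
    group
  rw [e] at h1
  rcases mem_rightInvSeq_append cs h1 with h2 | h2
  -- The deleted letter lies in the alternating part: two powers of the rotation with distinct
  -- exponents below its order would be equal.
  · obtain ⟨j, hj, e'⟩ := mem_rightInvSeq_alternatingWord cs h2
    have e'' : (cs.simple s * cs.simple t) ^ k = (cs.simple s * cs.simple t) ^ j := by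
      apply mul_left_cancel (a := cs.simple t)
      rw [← e']
      group
    have := pow_injOn_Iio_orderOf (x := cs.simple s * cs.simple t) (Set.mem_Iio.2 hk)
      (Set.mem_Iio.2 (hj.trans hk)) e''
    omega
  -- The deleted letter lies in the reduced word of u: a dihedral element would then shorten u by
  -- left multiplication.
  · have h3 := (cs.isRightInversion_of_mem_rightInvSeq hρ h2).2
    have hs : cs.simple s ∈ Subgroup.closure {cs.simple s, cs.simple t} :=
      Subgroup.subset_closure (by simp)
    have ht : cs.simple t ∈ Subgroup.closure {cs.simple s, cs.simple t} :=
      Subgroup.subset_closure (by simp)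
    have h4 := hu _ (mul_mem ht (pow_mem (mul_mem hs ht) k))
    rw [mul_assoc, mul_inv_cancel_left] at h3
    omega

theorem exists_alternatingWord_simple_mul {s t : B} (r : B) (hr : r = s ∨ r = t)
    (hd : 0 < orderOf (cs.simple s * cs.simple t)) {k : ℕ}
    (hk : k ≤ orderOf (cs.simple s * cs.simple t)) :
    ∃ j ≤ orderOf (cs.simple s * cs.simple t),
      cs.simple r * cs.wordProd (alternatingWord s t k) = cs.wordProd (alternatingWord s t j) ∨
      cs.simple r * cs.wordProd (alternatingWord s t k) = cs.wordProd (alternatingWord t s j) := by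
  by_cases hrk : r = if Even k then t else s
  · rcases hk.lt_or_eq with hlt | heq
    · exact ⟨k + 1, hlt, Or.inl (by rw [wordProd_alternatingWord_succ, hrk])⟩
    -- At the top the word is replaced by the other alternating word of the same length, whose
    -- leading letter is r and cancels.
    · obtain ⟨j, rfl⟩ : ∃ j, k = j + 1 := ⟨k - 1, by omega⟩
      refine ⟨j, by omega, Or.inr ?_⟩
      have e : r = if Even j then s else t := by
        rw [hrk]
        by_cases hj : Even j <;> simp [hj, Nat.even_add_one, -Nat.not_even_iff_odd]
      have := wordProd_alternatingWord_orderOf cs s t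
      rw [← heq] at this
      rw [← this, wordProd_alternatingWord_succ, e, simple_mul_simple_cancel_left]
  · cases k with
    | zero =>
      refine ⟨1, hd, Or.inr ?_⟩
      have : r = s := by simp_all
      simp [alternatingWord, this]
    | succ j =>
      refine ⟨j, by omega, Or.inl ?_⟩
      have e : r = if Even j then t else s := by
        by_cases hj : Even j <;> simp_all [Nat.even_add_one, -Nat.not_even_iff_odd]
      rw [wordProd_alternatingWord_succ, e, simple_mul_simple_cancel_left]

theorem exists_alternatingWord_of_mem_closure {s t : B}
    (hd : 0 < orderOf (cs.simple s * cs.simple t)) {g : W}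
    (hg : g ∈ Subgroup.closure {cs.simple s, cs.simple t}) :
    ∃ k ≤ orderOf (cs.simple s * cs.simple t),
      g = cs.wordProd (alternatingWord s t k) ∨ g = cs.wordProd (alternatingWord t s k) := by
  have key : ∀ r : B, r = s ∨ r = t → ∀ g : W, (∃ k ≤ orderOf (cs.simple s * cs.simple t),
      g = cs.wordProd (alternatingWord s t k) ∨ g = cs.wordProd (alternatingWord t s k)) →
      ∃ k ≤ orderOf (cs.simple s * cs.simple t), cs.simple r * g =
        cs.wordProd (alternatingWord s t k) ∨
        cs.simple r * g = cs.wordProd (alternatingWord t s k) := by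
    rintro r hr _ ⟨k, hk, rfl | rfl⟩
    · exact exists_alternatingWord_simple_mul cs r hr hd hk
    · rw [orderOf_simple_mul_simple_comm] at hd hk ⊢
      obtain ⟨j, hj, h⟩ := exists_alternatingWord_simple_mul cs r hr.symm hd hk
      exact ⟨j, hj, h.symm⟩
  induction hg using Subgroup.closure_induction_left with
  | one => exact ⟨0, by omega, by simp [alternatingWord]⟩
  | mul_left x hx y _ ih =>
    rcases hx with rfl | rfl
    · exact key s (by simp) y ih
    · exact key t (by simp) y ih
  | inv_mul_cancel x hx y _ ih =>
    rcases hx with rfl | rfl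
    · rw [inv_simple]; exact key s (by simp) y ih
    · rw [inv_simple]; exact key t (by simp) y ih

theorem exists_shortest_in_coset (s t : B) (x : W) :
    ∃ g ∈ Subgroup.closure {cs.simple s, cs.simple t}, ∃ u : W, x = g * u ∧
      ∀ h ∈ Subgroup.closure {cs.simple s, cs.simple t}, cs.length u ≤ cs.length (h * u) := by
  obtain ⟨⟨g, hg⟩, hmin⟩ := exists_minimalFor_of_wellFoundedLT
    (fun _ => True) (fun g : Subgroup.closure {cs.simple s, cs.simple t} => cs.length (g * x))
    ⟨1, trivial⟩
  refine ⟨g⁻¹, inv_mem hg, g * x, by simp, fun h hh => ?_⟩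
  have := hmin.2 (j := ⟨h * g, mul_mem hh hg⟩) trivial
  by_contra hlt
  have h2 := this (by simp only [mul_assoc]; omega)
  simp only [mul_assoc] at h2
  omega

end Dihedral

/-! ### Basis vectors of ℂX, extended by zero. -/

section Basis

variable {α : Type} (X : Set α)

open Classical in
/-- The basis vector of `ℂX` at `w`, or `0` if `w ∉ X`. -/
noncomputable def basisVec (w : α) : X →₀ ℂ := if h : w ∈ X then Finsupp.single ⟨w, h⟩ 1 else 0

theorem basisVec_coe (x : X) : basisVec X (x : α) = Finsupp.single x 1 := by
  simp [basisVec]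

variable {X} in
theorem basisVec_of_notMem {w : α} (h : w ∉ X) : basisVec X w = 0 := dif_neg h

end Basis

/-! ### The operators on ℂX and their braid relations. -/

section Action

variable {B W : Type} [Group W] {M : CoxeterMatrix B} (cs : CoxeterSystem M W) (X : Set W)

theorem piOp_basisVec_of_mem_Des {s : B} {w : W} (h : s ∈ Des cs w) :
    piOp cs X s (basisVec X w) = -basisVec X w := by
  by_cases hw : w ∈ X <;> simp [basisVec, piOp, hw, h]

open Classical in
-- The test `w ∈ X` cannot be dropped: outside X the input vector is zero, while `cs.simple s * w`
-- may lie in X.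
theorem piOp_basisVec_of_notMem_Des {s : B} {w : W} (h : s ∉ Des cs w) :
    piOp cs X s (basisVec X w) = if w ∈ X then basisVec X (cs.simple s * w) else 0 := by
  by_cases hw : w ∈ X <;> simp [basisVec, piOp, hw, h]

/-- The operator `⋯ π_a π_b` with `k` factors. -/
noncomputable def piAlternating (a b : B) (k : ℕ) : Module.End ℂ (X →₀ ℂ) :=
  ((alternatingWord a b k).map (piOp cs X)).prod

theorem piAlternating_succ_apply (a b : B) (k : ℕ) (v : X →₀ ℂ) :
    piAlternating cs X a b (k + 1) v =
      piOp cs X (if Even k then b else a) (piAlternating cs X a b k v) := by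
  rw [piAlternating, alternatingWord_succ', List.map_cons, List.prod_cons]
  rfl

theorem piAlternating_succ_apply' (a b : B) (k : ℕ) (v : X →₀ ℂ) :
    piAlternating cs X a b (k + 1) v = piAlternating cs X b a k (piOp cs X b v) := by
  rw [piAlternating, alternatingWord_succ, List.concat_eq_append, List.map_append, List.prod_append]
  simp [piAlternating]

/-- The element `⋯ s_a s_b x` with `k` simple factors. -/
def climb (a b : B) (k : ℕ) (x : W) : W := cs.wordProd (alternatingWord a b k) * x

theorem climb_zero (a b : B) (x : W) : climb cs a b 0 x = x := by
  simp [climb, alternatingWord]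

theorem climb_succ (a b : B) (k : ℕ) (x : W) :
    climb cs a b (k + 1) x = cs.simple (if Even k then b else a) * climb cs a b k x := by
  rw [climb, wordProd_alternatingWord_succ, mul_assoc, climb]

open Classical in
-- Once the chain leaves X the vector is 0 and stays 0, even if the chain re-enters X later; so all
-- intermediate elements are tested.
theorem piAlternating_of_ascents {a b : B} {x : W} {p : ℕ}
    (h : ∀ i < p, (if Even i then b else a) ∉ Des cs (climb cs a b i x)) :
    piAlternating cs X a b p (basisVec X x) =
      if ∀ i ≤ p, climb cs a b i x ∈ X then basisVec X (climb cs a b p x) else 0 := by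
  induction p with
  | zero =>
    by_cases hx : x ∈ X
    · simp [piAlternating, alternatingWord, climb, hx]
    · simp [piAlternating, alternatingWord, climb, hx, basisVec_of_notMem hx]
  | succ p ih =>
    rw [piAlternating_succ_apply, ih fun i hi => h i (by omega)]
    by_cases hp : ∀ i ≤ p, climb cs a b i x ∈ X
    · rw [if_pos hp, piOp_basisVec_of_notMem_Des cs X (h p (by omega)), if_pos (hp p le_rfl),
        ← climb_succ]
      by_cases hq : climb cs a b (p + 1) x ∈ X
      · rw [if_pos fun i hi => ?_]
        rcases Nat.le_succ_iff.1 hi with hi | rfl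
        · exact hp i hi
        · exact hq
      · rw [if_neg fun hi => hq (hi _ le_rfl), basisVec_of_notMem hq]
    · have hp' : ¬ ∀ i ≤ p + 1, climb cs a b i x ∈ X := fun hi => hp fun i hip => hi i (by omega)
      rw [if_neg hp, if_neg hp', map_zero]

open Classical in
theorem piAlternating_of_ascents_to_top {a b : B} {x : W} {p : ℕ}
    (h : ∀ i < p, (if Even i then b else a) ∉ Des cs (climb cs a b i x))
    (ha : a ∈ Des cs (climb cs a b p x)) (hb : b ∈ Des cs (climb cs a b p x)) (q : ℕ) :
    piAlternating cs X a b (p + q) (basisVec X x) =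
      (-1 : ℂ) ^ q • if ∀ i ≤ p, climb cs a b i x ∈ X then basisVec X (climb cs a b p x) else 0 := by
  induction q with
  | zero => simpa using piAlternating_of_ascents cs X h
  | succ q ih =>
    rw [← add_assoc, piAlternating_succ_apply, ih, map_smul, pow_succ, mul_smul]
    congr 1
    have hr : (if Even (p + q) then b else a) ∈ Des cs (climb cs a b p x) := by
      split_ifs <;> assumption
    by_cases hp : ∀ i ≤ p, climb cs a b i x ∈ X
    · rw [if_pos hp, piOp_basisVec_of_mem_Des cs X hr, neg_one_smul]
    · rw [if_neg hp, map_zero, smul_zero]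

/-- The product ending in a first produces a sign at x and then climbs with one factor fewer; the
other product climbs at once and has one more surplus sign at the top. The bound `p < N` supplies
that surplus factor. -/
theorem piAlternating_swap_of_mem_Des {a b : B} {x : W} {p N : ℕ} (hp : p < N)
    (h : ∀ i < p, (if Even i then b else a) ∉ Des cs (climb cs a b i x))
    (ha : a ∈ Des cs (climb cs a b p x)) (hb : b ∈ Des cs (climb cs a b p x))
    (hx : a ∈ Des cs x) :
    piAlternating cs X a b N (basisVec X x) = piAlternating cs X b a N (basisVec X x) := by
  classical
  obtain ⟨q, rfl⟩ : ∃ q, N = p + q + 1 := ⟨N - p - 1, by omega⟩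
  rw [piAlternating_succ_apply' cs X b a, piOp_basisVec_of_mem_Des cs X hx, map_neg, add_assoc,
    piAlternating_of_ascents_to_top cs X h ha hb, piAlternating_of_ascents_to_top cs X h ha hb,
    pow_succ, mul_neg_one, neg_smul]

variable {cs}

theorem notMem_Des_climb {s t : B} {u : W}
    (hu : ∀ g ∈ Subgroup.closure {cs.simple s, cs.simple t}, cs.length u ≤ cs.length (g * u))
    {k : ℕ} (hk : k < orderOf (cs.simple s * cs.simple t)) :
    (if Even k then t else s) ∉ Des cs (climb cs s t k u) :=
  not_isLeftDescent_alternatingWord cs hu hk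

theorem mem_Des_simple_mul {r : B} {w : W} (h : r ∉ Des cs w) : r ∈ Des cs (cs.simple r * w) := by
  by_contra h2
  exact h2 (cs.isLeftDescent_iff_not_isLeftDescent_mul.2
    (by rw [simple_mul_simple_cancel_left]; exact h))

theorem climb_orderOf_swap (s t : B) (u : W) :
    climb cs t s (orderOf (cs.simple s * cs.simple t)) u =
      climb cs s t (orderOf (cs.simple s * cs.simple t)) u := by
  rw [climb, wordProd_alternatingWord_orderOf, climb]

theorem mem_Des_climb_orderOf {s t : B} {u : W}
    (hu : ∀ g ∈ Subgroup.closure {cs.simple s, cs.simple t}, cs.length u ≤ cs.length (g * u))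
    (hd : 0 < orderOf (cs.simple s * cs.simple t)) {r : B} (hr : r = s ∨ r = t) :
    r ∈ Des cs (climb cs s t (orderOf (cs.simple s * cs.simple t)) u) := by
  obtain ⟨j, hj⟩ : ∃ j, orderOf (cs.simple s * cs.simple t) = j + 1 :=
    ⟨orderOf (cs.simple s * cs.simple t) - 1, by omega⟩
  by_cases hrj : r = if Even j then t else s
  · rw [hj, climb_succ, hrj]
    exact mem_Des_simple_mul (notMem_Des_climb hu (by omega))
  · have hrj' : r = if Even j then s else t := by
      by_cases hj : Even j <;> simp_all
    -- The remaining letter is the last one of the other chain, which ends at the same top.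
    rw [← climb_orderOf_swap, hj, climb_succ, hrj']
    refine mem_Des_simple_mul (notMem_Des_climb (by rwa [Set.pair_comm]) ?_)
    rw [orderOf_simple_mul_simple_comm]
    omega

theorem climb_climb (s t : B) (k i : ℕ) (u : W) :
    climb cs (if Even k then s else t) (if Even k then t else s) i (climb cs s t k u) =
      climb cs s t (k + i) u := by
  induction i with
  | zero => rw [climb_zero, add_zero]
  | succ i ih =>
    rw [climb_succ, ih, ← add_assoc, climb_succ]
    congr 2
    by_cases hk : Even k <;> by_cases hi : Even i <;> simp [hk, hi, Nat.even_add]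

theorem climb_inv_mul_simple_mul_climb (s t : B) (k : ℕ) (u : W) :
    (climb cs s t k u)⁻¹ * cs.simple (if Even k then t else s) * climb cs s t k u =
      u⁻¹ * (cs.simple t * (cs.simple s * cs.simple t) ^ k) * u := by
  rw [← conj_alternatingWord, climb]
  group

variable {X}

theorem climb_mem_of_climb_mem (hX : AscentCompatible cs X) {s t : B} {u : W}
    (hu : ∀ g ∈ Subgroup.closure {cs.simple s, cs.simple t}, cs.length u ≤ cs.length (g * u))
    (h : ∀ i ≤ orderOf (cs.simple s * cs.simple t), climb cs s t i u ∈ X) :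
    ∀ i ≤ orderOf (cs.simple s * cs.simple t), climb cs t s i u ∈ X := by
  intro i
  induction i with
  | zero => intro _; simpa [climb_zero] using h 0 (by omega)
  | succ i ih =>
    intro hi
    -- Step i of the second chain uses the same reflection as step k of the first, with k counted
    -- from the opposite end; the two ascents are aligned.
    obtain ⟨k, hk⟩ : ∃ k, k + i + 1 = orderOf (cs.simple s * cs.simple t) :=
      ⟨orderOf (cs.simple s * cs.simple t) - (i + 1), by omega⟩
    rw [climb_succ]
    refine (hX _ (h k (by omega)) _ (ih (by omega)) (if Even k then t else s) _
      ⟨notMem_Des_climb hu (by omega), notMem_Des_climb (by rwa [Set.pair_comm]) ?_, ?_⟩).1 ?_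
    · rw [orderOf_simple_mul_simple_comm]
      omega
    · rw [climb_inv_mul_simple_mul_climb, climb_inv_mul_simple_mul_climb,
        conj_alternatingWord_swap cs s t hk]
    · rw [← climb_succ]
      exact h _ (by omega)

/-- Both products reach the same top with the same number of surplus signs, and by
ascent-compatibility both survive or both vanish. -/
theorem piAlternating_swap_of_shortest (hX : AscentCompatible cs X) {s t : B} {u : W}
    (hu : ∀ g ∈ Subgroup.closure {cs.simple s, cs.simple t}, cs.length u ≤ cs.length (g * u))
    (hd : 0 < orderOf (cs.simple s * cs.simple t)) {N : ℕ}
    (hN : orderOf (cs.simple s * cs.simple t) ≤ N) :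
    piAlternating cs X s t N (basisVec X u) = piAlternating cs X t s N (basisVec X u) := by
  classical
  have hu' : ∀ g ∈ Subgroup.closure {cs.simple t, cs.simple s},
      cs.length u ≤ cs.length (g * u) := by rwa [Set.pair_comm]
  have hc := orderOf_simple_mul_simple_comm cs s t
  obtain ⟨q, rfl⟩ := Nat.exists_eq_add_of_le hN
  have h1 := piAlternating_of_ascents_to_top cs X (fun i hi => notMem_Des_climb hu hi)
    (mem_Des_climb_orderOf hu hd (Or.inl rfl)) (mem_Des_climb_orderOf hu hd (Or.inr rfl)) q
  have h2 := piAlternating_of_ascents_to_top cs X (fun i hi => notMem_Des_climb hu' hi)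
    (mem_Des_climb_orderOf hu' (hc ▸ hd) (Or.inl rfl))
    (mem_Des_climb_orderOf hu' (hc ▸ hd) (Or.inr rfl)) q
  rw [← hc] at h2
  have hiff : (∀ i ≤ orderOf (cs.simple s * cs.simple t), climb cs s t i u ∈ X) ↔
      ∀ i ≤ orderOf (cs.simple s * cs.simple t), climb cs t s i u ∈ X := by
    refine ⟨climb_mem_of_climb_mem hX hu, ?_⟩
    rw [hc]
    exact climb_mem_of_climb_mem hX hu'
  rw [h1, h2, climb_orderOf_swap]
  simp only [hiff]

theorem piAlternating_swap_climb (hX : AscentCompatible cs X) {s t : B} {u : W}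
    (hu : ∀ g ∈ Subgroup.closure {cs.simple s, cs.simple t}, cs.length u ≤ cs.length (g * u))
    {N k : ℕ} (hd : 0 < orderOf (cs.simple s * cs.simple t))
    (hN : orderOf (cs.simple s * cs.simple t) ≤ N)
    (hk : k ≤ orderOf (cs.simple s * cs.simple t)) :
    piAlternating cs X s t N (basisVec X (climb cs s t k u)) =
      piAlternating cs X t s N (basisVec X (climb cs s t k u)) := by
  cases k with
  | zero => rw [climb_zero]; exact piAlternating_swap_of_shortest hX hu hd hN
  | succ k =>
    have hsum : k + 1 + (orderOf (cs.simple s * cs.simple t) - (k + 1)) =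
      orderOf (cs.simple s * cs.simple t) := by omega
    -- The letter a is the one that made the last step up to this element, hence a descent; b
    -- continues the chain to the top.
    have key := piAlternating_swap_of_mem_Des cs X
      (a := if Even (k + 1) then s else t) (b := if Even (k + 1) then t else s)
      (x := climb cs s t (k + 1) u) (p := orderOf (cs.simple s * cs.simple t) - (k + 1)) (N := N)
      (by omega)
      (fun i hi => by
        rw [climb_climb]
        have := notMem_Des_climb hu (k := k + 1 + i) (by omega)
        convert this using 2
        by_cases hk : Even (k + 1) <;> by_cases hi : Even i <;> simp [hk, hi, Nat.even_add])
      (by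
        rw [climb_climb, hsum]
        exact mem_Des_climb_orderOf hu hd (by split_ifs <;> simp))
      (by
        rw [climb_climb, hsum]
        exact mem_Des_climb_orderOf hu hd (by split_ifs <;> simp))
      (by
        have e : (if Even (k + 1) then s else t) = if Even k then t else s := by
          by_cases hk : Even k <;> simp [hk, Nat.even_add_one, -Nat.not_even_iff_odd]
        rw [climb_succ, e]
        exact mem_Des_simple_mul (notMem_Des_climb hu (by omega)))
    by_cases hk : Even (k + 1)
    · simpa only [hk, if_true] using key
    · simpa only [hk, if_false] using key.symm

/-- The operators `π_s` on `ℂX` satisfy the braid relations. -/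
theorem piAlternating_swap (hX : AscentCompatible cs X) (s t : B) (hm : M s t ≠ 0) :
    piAlternating cs X s t (M s t) = piAlternating cs X t s (M s t) := by
  have hdvd : orderOf (cs.simple s * cs.simple t) ∣ M s t :=
    orderOf_dvd_of_pow_eq_one (cs.simple_mul_simple_pow s t)
  have hd : 0 < orderOf (cs.simple s * cs.simple t) :=
    Nat.pos_of_ne_zero fun h => hm (by rwa [h, zero_dvd_iff] at hdvd)
  have hN := Nat.le_of_dvd (Nat.pos_of_ne_zero hm) hdvd
  refine Finsupp.lhom_ext' fun x => LinearMap.ext_ring ?_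
  simp only [LinearMap.comp_apply, Finsupp.lsingle_apply]
  rw [← basisVec_coe]
  obtain ⟨g, hg, u, hgu, hu⟩ := exists_shortest_in_coset cs s t (x : W)
  rw [hgu]
  obtain ⟨k, hk, rfl | rfl⟩ := exists_alternatingWord_of_mem_closure cs hd hg
  · exact piAlternating_swap_climb hX hu hd hN hk
  · rw [orderOf_simple_mul_simple_comm] at hd hN hk
    exact (piAlternating_swap_climb hX (by rwa [Set.pair_comm]) hd hN hk).symm

theorem piOp_mul_self (s : B) : piOp cs X s * piOp cs X s = -piOp cs X s := by
  classical
  refine Finsupp.lhom_ext' fun x => LinearMap.ext_ring ?_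
  simp only [LinearMap.comp_apply, Finsupp.lsingle_apply, Module.End.mul_apply,
    LinearMap.neg_apply]
  rw [← basisVec_coe]
  by_cases h : s ∈ Des cs (x : W)
  · simp [piOp_basisVec_of_mem_Des cs X h]
  -- After an ascent s has become a descent, so the second application only changes the sign; this
  -- also covers the zero vector when the image leaves X.
  · rw [piOp_basisVec_of_notMem_Des cs X h, if_pos x.2,
      piOp_basisVec_of_mem_Des cs X (mem_Des_simple_mul h)]

/-- The action of the `0`-Hecke algebra on `ℂX` for an ascent-compatible set `X`. -/
noncomputable def ascentRep (hX : AscentCompatible cs X) :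
    ZeroHecke M →ₐ[ℂ] Module.End ℂ (X →₀ ℂ) :=
  ZeroHecke.lift (piOp cs X) piOp_mul_self fun s t _ hm => piAlternating_swap hX s t hm

theorem ascentRep_gen (hX : AscentCompatible cs X) (s : B) :
    ascentRep hX (ZeroHecke.gen M s) = piOp cs X s :=
  ZeroHecke.lift_gen _ _ _ s

end Action

/-! ### Traces on ℂX by triangularity. -/

section Trace

theorem traceOn_moduleOfRep {A : Type} [Ring A] [Algebra ℂ A] {V : Type} [AddCommGroup V]
    [Module ℂ V] (ρ : A →ₐ[ℂ] Module.End ℂ V) (hV : Module.Finite ℂ V) (a : A) :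
    traceOn a (moduleOfRep ρ hV) = LinearMap.trace ℂ V (ρ a) := by
  let U := moduleOfRep ρ hV
  let := complexModule A U
  have := complexModule_tower (A := A) U
  -- The complex structure restored through `algebraMap` is the original one, so the identity is
  -- linear and preserves the trace.
  let e : V ≃ₗ[ℂ] U :=
    { toFun := fun v => v
      invFun := fun v => v
      map_add' := fun _ _ => rfl
      map_smul' := fun c v => by
        change c • v = ρ (algebraMap ℂ A c) v
        rw [AlgHom.commutes]
        rfl
      left_inv := fun _ => rfl
      right_inv := fun _ => rfl }
  rw [← LinearMap.trace_conj' (ρ a) e]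
  rfl

variable {B W : Type} [Group W] {M : CoxeterMatrix B} {cs : CoxeterSystem M W} {X : Set W}

/-- The action on `ℂX` is triangular with respect to the length, and the diagonal entry at `x` is
the character attached to the descents of `x`. -/
theorem ascentRep_apply_of_length_le (hX : AscentCompatible cs X) (a : ZeroHecke M) (x y : X)
    (h : cs.length (y : W) ≤ cs.length (x : W)) :
    ascentRep hX a (Finsupp.single x 1) y =
      Finsupp.single x (ZeroHecke.char (Des cs (x : W)) a) y := by
  classical
  induction a using ZeroHecke.induction generalizing x y with
  | hc c => simp [AlgHom.commutes]
  | hg s =>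
    rw [ascentRep_gen, ZeroHecke.char, ZeroHecke.lift_gen, ← basisVec_coe]
    by_cases hs : s ∈ Des cs (x : W)
    · rw [piOp_basisVec_of_mem_Des cs X hs, if_pos hs, basisVec_coe, Finsupp.single_neg]
    · rw [piOp_basisVec_of_notMem_Des cs X hs, if_pos x.2, if_neg hs, Finsupp.single_zero]
      by_cases hx : cs.simple s * (x : W) ∈ X
      · have hne : (⟨cs.simple s * (x : W), hx⟩ : X) ≠ y := by
          rintro rfl
          have := cs.not_isLeftDescent_iff.1 hs
          simp only at h
          omega
        simp [basisVec, hx, hne.symm]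
      · simp [basisVec_of_notMem hx]
  | ha a b h1 h2 => simp [h1 x y h, h2 x y h, Finsupp.single_add]
  | hm a b h1 h2 =>
    set v := ascentRep hX b (Finsupp.single x 1) with hv
    have hsum : ascentRep hX a v = v.sum fun z c => c • ascentRep hX a (Finsupp.single z 1) := by
      conv_lhs => rw [← Finsupp.sum_single v]
      rw [map_finsuppSum]
      refine Finsupp.sum_congr fun z _ => ?_
      rw [← map_smul, Finsupp.smul_single, smul_eq_mul, mul_one]
    have hvx : v x = ZeroHecke.char (Des cs (x : W)) b := by
      rw [hv, h2 x x le_rfl, Finsupp.single_eq_same]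
    rw [map_mul, Module.End.mul_apply, ← hv, hsum, Finsupp.sum_apply, Finsupp.sum,
      Finset.sum_eq_single x]
    · rw [Finsupp.smul_apply, h1 x y h, hvx, map_mul, mul_comm, ← smul_eq_mul,
        ← Finsupp.smul_single, Finsupp.smul_apply]
    -- Any other z in the support of the image under b is longer than x, hence longer than y, so a
    -- cannot carry it back to y.
    · intro z hz hzx
      rw [Finsupp.mem_support_iff] at hz
      have hlt : cs.length (x : W) < cs.length (z : W) := by
        by_contra hle
        exact hz (by rw [hv, h2 x z (by omega), Finsupp.single_eq_of_ne hzx])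
      have hyz : y ≠ z := by
        rintro rfl
        omega
      rw [Finsupp.smul_apply, h1 z y (by omega), Finsupp.single_eq_of_ne hyz, smul_zero]
    · intro hx
      rw [Finsupp.notMem_support_iff] at hx
      rw [hx, zero_smul, Finsupp.zero_apply]

theorem trace_ascentRep [Fintype X] (hX : AscentCompatible cs X) (a : ZeroHecke M) :
    LinearMap.trace ℂ (X →₀ ℂ) (ascentRep hX a) =
      ∑ x : X, ZeroHecke.char (Des cs (x : W)) a := by
  classical
  rw [LinearMap.trace_eq_matrix_trace ℂ Finsupp.basisSingleOne, Matrix.trace]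
  refine Finset.sum_congr rfl fun x _ => ?_
  rw [Matrix.diag_apply, LinearMap.toMatrix_apply, Finsupp.coe_basisSingleOne]
  change ascentRep hX a (Finsupp.single x 1) x = _
  rw [ascentRep_apply_of_length_le hX a x x le_rfl, Finsupp.single_eq_same]

end Trace

/-! ### The characteristic as a combination of traces. -/

theorem chB_apply (n : ℕ) (z : G0 (HeckeB n)) :
    chB n z = ∑ I : Set (Fin n), traceHom (dualElement I) z • fundamentalB n I := by
  classical
  have h : chB n = ∑ I : Set (Fin n), ((AddMonoidHom.flip (smulAddHom ℂ (MvPowerSeries ℕ ℂ))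
      (fundamentalB n I)).comp (traceHom (dualElement I))) :=
    -- `chB` is given only by choice; uniqueness identifies it with the explicit sum, which also has
    -- the prescribed values on simple classes.
    (existsUnique_characteristic n).unique chB_simpleClass fun J => by
      simp [traceHom_simpleClass, char_dualElement]
  simp [h]

theorem chB_ascentRep {n : ℕ} {W : Type} [Group W] {cs : CoxeterSystem (matrixB n) W} {X : Set W}
    (hX : AscentCompatible cs X) :
    chB n (G0.mk (moduleOfRep (ascentRep hX) (finite_free cs X))) =
      ∑ᶠ x ∈ X, fundamentalB n (Des cs x) := by
  classical
  have := finite_group cs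
  have := Fintype.ofFinite X
  rw [chB_apply, ← finsum_set_coe_eq_finsum_mem, finsum_eq_sum_of_fintype]
  simp_rw [traceHom_mk, traceOn_moduleOfRep, trace_ascentRep, Finset.sum_smul, char_dualElement]
  -- With the sum over x outermost, only the term I = Des(x) survives for each x.
  rw [Finset.sum_comm]
  simp

end TypeB

theorem mainTheorem3 (n : ℕ) {W : Type} [Group W]
    (cs : CoxeterSystem (TypeB.matrixB n) W) (X : Set W) (hX : TypeB.AscentCompatible cs X) :
    ∃ ρ : TypeB.HeckeB n →ₐ[ℂ] Module.End ℂ (X →₀ ℂ),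
      (∀ s : Fin n, ρ (TypeB.ZeroHecke.gen (TypeB.matrixB n) s) = TypeB.piOp cs X s) ∧
      TypeB.chB n (TypeB.G0.mk (TypeB.moduleOfRep ρ (TypeB.finite_free cs X))) =
        ∑ᶠ x ∈ X, TypeB.fundamentalB n (TypeB.Des cs x) :=
  ⟨TypeB.ascentRep hX, TypeB.ascentRep_gen hX, TypeB.chB_ascentRep hX⟩
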